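/- Let $p\ge 1$ and $N\ge 2$ be integers, let $s_n>0$ ($n\ge1$) with $\sum_n s_n<\infty$, and for each $n\ge 1$ let $\mathcal D^n=\{0=d^n_1,d^n_2,\dots,d^n_N\}\subset\mathbb R^p$ be a digit set. Put $$C_{s,\mathcal D}=\Big\{\sum_{i=1}^\infty s_i b_i : b_i\in\mathcal D^i\Big\},\qquad R_n=\sum_{i>n}s_i\quad(n\ge 0),$$ $$\kappa=\sup_{n\ge 1}\max_{i\ne j}\|d^n_i-d^n_j\|,\qquad \tau=\inf_{n\ge 1}\min_{i\ne j}\|d^n_i-d^n_j\|,$$ with the Euclidean norm, and assume $\kappa<\infty$, $\tau>0$ and $\sup_{n\ge1}\frac{\kappa R_n}{\tau s_n}=M<1$. Let $h:[0,\infty)\to[0,\infty)$ be a doubling dimension function, i.e. $h$ is continuous and non-decreasing, $h(0)=0$, and there is a constant $c>0$ (a doubling constant of $h$) with $h(2x)\le c\,h(x)$ for all $x>0$. Let $\mathcal H^h$ be the Hausdorff $h$-measure, $\mathcal H^h(E)=\lim_{\delta\to0}\inf\{\sum_i h(|B_i|)\}$, the infimum over all countable coverings $\{B_i\}$ of $E$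 by sets of diameter $|B_i|\le\delta$. Let $\mathcal P^h$ be the $h$-packing measure, $$\mathcal P^h(E)=\inf\Big\{\sum_{i=1}^{\infty}\mathcal P^h_0(E_i):E\subseteq\bigcup_i E_i\Big\},\qquad \mathcal P^h_0(E)=\lim_{\delta\to0}\sup\Big\{\sum_i h(r_i)\Big\},$$ the supremum over all families of pairwise disjoint open balls $B(x_i,r_i)$ with $x_i\in E$ and $0<r_i\le\delta$; let $\mathcal P^h_{\mathrm{diam}}$ be defined in the same way with $h(|B(x_i,r_i)|)$ (the gauge evaluated at the diameter of the ball) in place of $h(r_i)$. All limits below are as $n\to\infty$, and $\alpha\in[0,\infty]$. 1. If $\liminf N^n h(\kappa R_n)=\alpha$, then $\mathcal H^h(C_{s,\mathcal D})\le\alpha$. 2. If $\liminf N^n h(\kappa R_n)=\alpha>0$, then $\mathcal H^h(C_{s,\mathcal D})>0$. 3. If $\limsup N^n h(\kappa R_n)=\alpha<\infty$, then $\mathcal P^h(C_{s,\mathcal D})\le N\alpha$, and $\mathcal P^h_{\mathrm{diam}}(C_{s,\mathcal D})\le cN\alpha$ for every doubling constant $c$ of $h$. 4. If $\limsup N^n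 h(\kappa R_n)=\alpha>0$, then $\mathcal P^h(C_{s,\mathcal D})>0$ and $\mathcal P^h_{\mathrm{diam}}(C_{s,\mathcal D})>0$. -/

import Mathlib

open Set Filter Topology MeasureTheory
open scoped NNReal ENNReal

noncomputable section

/-- A dimension function: continuous, non-decreasing `h : [0,∞) → [0,∞)` with `h 0 = 0`. -/
structure IsDimensionFunction (h : ℝ≥0 → ℝ≥0) : Prop where
  continuous : Continuous h
  monotone : Monotone h
  map_zero : h 0 = 0

/-- `c` is a doubling constant for `h`. -/
def IsDoublingConstant (h : ℝ≥0 → ℝ≥0) (c : ℝ≥0) : Prop :=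
  0 < c ∧ ∀ x : ℝ≥0, 0 < x → h (2 * x) ≤ c * h x

/-- `h` is doubling. -/
def IsDoubling (h : ℝ≥0 → ℝ≥0) : Prop :=
  ∃ c : ℝ≥0, IsDoublingConstant h c

/-- The Hausdorff `h`-measure: the limit as `δ → 0` of the infimum of `∑ h(|Bᵢ|)` over countable
coverings by sets of diameter at most `δ`. (Unbounded sets get weight `∞`; they do not occur in
`δ`-coverings with `δ` finite.) -/
def hausdorffGaugeMeasure {X : Type*} [MetricSpace X] [MeasurableSpace X] [BorelSpace X]
    (h : ℝ≥0 → ℝ≥0) : Measure X :=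
  Measure.mkMetric fun t : ℝ≥0∞ => if t = ⊤ then ⊤ else (h t.toNNReal : ℝ≥0∞)

/-- A `δ`-packing of `E`: a disjoint family of open balls with centres in `E` and radii in
`(0, δ]`, given as a set of pairs (centre, radius). -/
structure IsPacking {X : Type*} [MetricSpace X] (δ : ℝ≥0) (E : Set X) (T : Set (X × ℝ≥0)) :
    Prop where
  center_mem : ∀ b ∈ T, b.1 ∈ E
  radius_pos : ∀ b ∈ T, 0 < b.2
  radius_le : ∀ b ∈ T, b.2 ≤ δ
  disjoint : T.PairwiseDisjoint fun b => Metric.ball b.1 (b.2 : ℝ)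

/-- The supremum of the total weight of `δ`-packings of `E`, the ball `B(x, r)` having
weight `w x r`. -/
def packingDelta {X : Type*} [MetricSpace X] (w : X → ℝ≥0 → ℝ≥0) (δ : ℝ≥0) (E : Set X) : ℝ≥0∞ :=
  ⨆ (T : Set (X × ℝ≥0)) (_ : IsPacking δ E T), ∑' b : T, (w b.1.1 b.1.2 : ℝ≥0∞)

/-- The packing pre-measure: the limit (= infimum, by monotonicity) as `δ → 0`. -/
def packingPre {X : Type*} [MetricSpace X] (w : X → ℝ≥0 → ℝ≥0) (E : Set X) : ℝ≥0∞ :=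
  ⨅ (δ : ℝ≥0) (_ : 0 < δ), packingDelta w δ E

/-- The packing measure obtained from the pre-measure through countable coverings. -/
def packingOuter {X : Type*} [MetricSpace X] (w : X → ℝ≥0 → ℝ≥0) (E : Set X) : ℝ≥0∞ :=
  ⨅ (A : ℕ → Set X) (_ : E ⊆ ⋃ i, A i), ∑' i, packingPre w (A i)

/-- The `h`-packing measure, the gauge being evaluated at the radius of each ball. -/
def packingMeasure {X : Type*} [MetricSpace X] (h : ℝ≥0 → ℝ≥0) (E : Set X) : ℝ≥0∞ :=
  packingOuter (fun _ r => h r) E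

/-- The `h`-packing measure, the gauge being evaluated at the diameter of each ball. -/
def packingMeasureDiam {X : Type*} [MetricSpace X] (h : ℝ≥0 → ℝ≥0) (E : Set X) : ℝ≥0∞ :=
  packingOuter (fun x r => h (Metric.diam (Metric.ball x (r : ℝ))).toNNReal) E

/-! Sequences indexed by `1, 2, 3, …` in mathematical notation are indexed by `0, 1, 2, …` here:
`s i` is `s_{i+1}` and `d i` lists the digit set `D^{i+1}`. -/

/-- The sum set `C_{s,D}` of all `∑ sᵢ bᵢ` with `bᵢ` in the `i`-th digit set. -/
def sumSet {p N : ℕ} (s : ℕ → ℝ) (d : ℕ → Fin N → EuclideanSpace ℝ (Fin p)) :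
    Set (EuclideanSpace ℝ (Fin p)) :=
  {x | ∃ σ : ℕ → Fin N, HasSum (fun i => s i • d i (σ i)) x}

/-- `R_n = ∑_{i > n} s_i`; in the shifted indexing the first `n` terms are left out. -/
def tailSum (s : ℕ → ℝ) (n : ℕ) : ℝ :=
  ∑' i, s (n + i)

/-- The largest distance between digits with different indices in one digit set. -/
def digitMax {p N : ℕ} (e : Fin N → EuclideanSpace ℝ (Fin p)) : ℝ :=
  ⨆ q : {q : Fin N × Fin N // q.1 ≠ q.2}, ‖e q.1.1 - e q.1.2‖

/-- The smallest distance between digits with different indices in one digit set. -/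
def digitMin {p N : ℕ} (e : Fin N → EuclideanSpace ℝ (Fin p)) : ℝ :=
  ⨅ q : {q : Fin N × Fin N // q.1 ≠ q.2}, ‖e q.1.1 - e q.1.2‖

/-- `κ = sup_n κ_n`. -/
def digitKappa {p N : ℕ} (d : ℕ → Fin N → EuclideanSpace ℝ (Fin p)) : ℝ :=
  ⨆ n, digitMax (d n)

/-- `τ = inf_n τ_n`. -/
def digitTau {p N : ℕ} (d : ℕ → Fin N → EuclideanSpace ℝ (Fin p)) : ℝ :=
  ⨅ n, digitMin (d n)

/-- The quantity `N^n h(κ R_n)`. -/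
def gaugeSeq {p N : ℕ} (h : ℝ≥0 → ℝ≥0) (s : ℕ → ℝ)
    (d : ℕ → Fin N → EuclideanSpace ℝ (Fin p)) (n : ℕ) : ℝ≥0∞ :=
  (N : ℝ≥0∞) ^ n * (h (digitKappa d * tailSum s n).toNNReal : ℝ≥0∞)

end

/-! Digit sequences code the sum set, and `M < 1` controls distances in both directions. Agreement
in the first `n` places gives distance at most `κ R_n`. A first difference at place `n` gives
distance at least the gap `(1 - M) τ s_n` (`le_dist_codingMap_of_first_ne`). Gap and tail are
comparable, so by doubling their gauges are too (`exists_gauge_tail_le`).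

The uniform Bernoulli measure gives each cylinder of length `n` mass `N⁻ⁿ`, so `Nⁿ h(κ R_n)`
compares gauge with mass. Hausdorff measure is bounded above by covering with cylinders, and below
by the mass distribution principle: a small set lies in one cylinder. For packings, each ball
contains a cylinder of comparable size, and disjoint balls have total mass at most 1. Conversely,
choosing one point per cylinder gives a packing that bounds the pre-measure of any set below by its
mass. -/

/-! ### Coding by digit sequences and separation estimates. -/

section Coding

variable {p N : ℕ}

/-- Scales `s` and digits `d` whose sum set satisfies a strong separation condition: digits have
norm and mutual distances at most `κ`, distinct digits are at least `τ` apart, and the tails of `s`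
are small compared with its terms. -/
structure SeparatedDigits (s : ℕ → ℝ) (d : ℕ → Fin N → EuclideanSpace ℝ (Fin p))
    (κ τ M : ℝ) : Prop where
  scale_pos : ∀ i, 0 < s i
  summable : Summable s
  norm_le : ∀ i a, ‖d i a‖ ≤ κ
  dist_le : ∀ i a b, ‖d i a - d i b‖ ≤ κ
  le_dist : ∀ i a b, a ≠ b → τ ≤ ‖d i a - d i b‖
  tau_pos : 0 < τ
  tau_le : τ ≤ κ
  tail_le : ∀ n, κ * tailSum s (n + 1) ≤ M * (τ * s n)
  ratio_lt : M < 1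

/-- The point of the sum set with digit sequence `σ`. -/
noncomputable def codingMap (s : ℕ → ℝ) (d : ℕ → Fin N → EuclideanSpace ℝ (Fin p)) (σ : ℕ → Fin N) :
    EuclideanSpace ℝ (Fin p) :=
  ∑' i, s i • d i (σ i)

namespace SeparatedDigits

variable {s : ℕ → ℝ} {d : ℕ → Fin N → EuclideanSpace ℝ (Fin p)} {κ τ M : ℝ}

theorem kappa_pos (H : SeparatedDigits s d κ τ M) : 0 < κ := H.tau_pos.trans_le H.tau_le

theorem norm_term_le (H : SeparatedDigits s d κ τ M) (i : ℕ) (a : Fin N) :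
    ‖s i • d i a‖ ≤ κ * s i := by
  rw [norm_smul, Real.norm_of_nonneg (H.scale_pos i).le, mul_comm]
  exact mul_le_mul_of_nonneg_right (H.norm_le i a) (H.scale_pos i).le

theorem summable_term (H : SeparatedDigits s d κ τ M) (σ : ℕ → Fin N) :
    Summable fun i => s i • d i (σ i) :=
  Summable.of_norm_bounded (H.summable.mul_left κ) fun i => H.norm_term_le i (σ i)

theorem continuous_codingMap (H : SeparatedDigits s d κ τ M) : Continuous (codingMap s d) :=
  continuous_tsum
    (fun i => (((continuous_of_discreteTopology (f := d i)).comp'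
      (continuous_apply i)).const_smul (s i)))
    (H.summable.mul_left κ) fun i σ => H.norm_term_le i (σ i)

theorem sumSet_eq_range (H : SeparatedDigits s d κ τ M) :
    sumSet s d = range (codingMap s d) := by
  ext x
  constructor
  · rintro ⟨σ, hσ⟩
    exact ⟨σ, hσ.tsum_eq⟩
  · rintro ⟨σ, rfl⟩
    exact ⟨σ, (H.summable_term σ).hasSum⟩

theorem summable_tail (H : SeparatedDigits s d κ τ M) (n : ℕ) : Summable fun i => s (n + i) := by
  simpa only [add_comm n] using (summable_nat_add_iff n).2 H.summable

theorem tailSum_pos (H : SeparatedDigits s d κ τ M) (n : ℕ) : 0 < tailSum s n :=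
  (H.summable_tail n).tsum_pos (fun _ => (H.scale_pos _).le) 0 (H.scale_pos _)

theorem tailSum_eq_add (H : SeparatedDigits s d κ τ M) (n : ℕ) :
    tailSum s n = s n + tailSum s (n + 1) := by
  rw [tailSum, (H.summable_tail n).tsum_eq_zero_add]
  simp only [tailSum, add_zero, add_assoc, add_comm 1]

/-- Summability is not needed: if `s` is not summable, every tail is 0 by the default value of
`tsum`. -/
theorem _root_.tendsto_mul_tailSum (κ : ℝ) (s : ℕ → ℝ) :
    Tendsto (fun n => κ * tailSum s n) atTop (𝓝 0) := by
  have := (tendsto_sum_nat_add s).const_mul κ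
  simpa only [tailSum, add_comm, mul_zero] using this

theorem tail_le_term (H : SeparatedDigits s d κ τ M) (n : ℕ) :
    κ * tailSum s (n + 1) ≤ τ * s n := by
  have h1 := H.tail_le n
  have h2 := mul_pos H.tau_pos (H.scale_pos n)
  nlinarith [H.ratio_lt]

/-- Since `τ ≤ κ`, the tail bound gives `s (n + 1) ≤ tailSum s (n + 1) ≤ s n`. Hence the gap at
place `n` bounds all earlier gaps from below. -/
theorem scale_antitone (H : SeparatedDigits s d κ τ M) : Antitone s := by
  refine antitone_nat_of_succ_le fun n => ?_
  have h1 := H.tail_le_term n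
  have h2 := H.tailSum_eq_add (n + 1)
  have h3 := H.tailSum_pos (n + 1 + 1)
  have h4 : τ * tailSum s (n + 1) ≤ κ * tailSum s (n + 1) :=
    mul_le_mul_of_nonneg_right H.tau_le (H.tailSum_pos _).le
  have h5 := le_of_mul_le_mul_left (h4.trans h1) H.tau_pos
  linarith

theorem norm_codingMap_tail_le (H : SeparatedDigits s d κ τ M) (σ ω : ℕ → Fin N) (n : ℕ) :
    ‖∑' i, s (n + i) • (d (n + i) (σ (n + i)) - d (n + i) (ω (n + i)))‖ ≤ κ * tailSum s n := by
  refine tsum_of_norm_bounded ((H.summable_tail n).hasSum.mul_left κ) fun i => ?_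
  rw [norm_smul, Real.norm_of_nonneg (H.scale_pos _).le, mul_comm]
  exact mul_le_mul_of_nonneg_right (H.dist_le _ _ _) (H.scale_pos _).le

theorem codingMap_sub_eq (H : SeparatedDigits s d κ τ M) {σ ω : ℕ → Fin N} {n : ℕ}
    (h : ∀ i < n, σ i = ω i) :
    codingMap s d σ - codingMap s d ω =
      ∑' i, s (n + i) • (d (n + i) (σ (n + i)) - d (n + i) (ω (n + i))) := by
  have hs := (H.summable_term σ).sub (H.summable_term ω)
  rw [codingMap, codingMap, ← (H.summable_term σ).tsum_sub (H.summable_term ω),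
    ← hs.sum_add_tsum_nat_add n, Finset.sum_eq_zero, zero_add]
  · simp only [smul_sub, add_comm n]
  · intro i hi
    rw [h i (Finset.mem_range.1 hi), sub_self]

theorem dist_codingMap_le (H : SeparatedDigits s d κ τ M) {σ ω : ℕ → Fin N} {n : ℕ}
    (h : ∀ i < n, σ i = ω i) :
    dist (codingMap s d σ) (codingMap s d ω) ≤ κ * tailSum s n := by
  rw [dist_eq_norm, H.codingMap_sub_eq h]
  exact H.norm_codingMap_tail_le σ ω n

/-- The term at place `n` contributes at least `τ s_n`, and all later ones together at most `κ
R_{n+1} ≤ M τ s_n`. -/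
theorem le_dist_codingMap_of_first_ne (H : SeparatedDigits s d κ τ M) {σ ω : ℕ → Fin N} {n : ℕ}
    (h : ∀ i < n, σ i = ω i) (hn : σ n ≠ ω n) :
    (1 - M) * τ * s n ≤ dist (codingMap s d σ) (codingMap s d ω) := by
  have hsum : Summable fun i => s (n + i) • (d (n + i) (σ (n + i)) - d (n + i) (ω (n + i))) := by
    have := (summable_nat_add_iff n).2 ((H.summable_term σ).sub (H.summable_term ω))
    simpa only [smul_sub, add_comm n] using this
  have htail := H.norm_codingMap_tail_le σ ω (n + 1)
  have hhead : τ * s n ≤ ‖s n • (d n (σ n) - d n (ω n))‖ := by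
    rw [norm_smul, Real.norm_of_nonneg (H.scale_pos _).le, mul_comm]
    exact mul_le_mul_of_nonneg_left (H.le_dist _ _ _ hn) (H.scale_pos _).le
  rw [dist_eq_norm, H.codingMap_sub_eq h, hsum.tsum_eq_zero_add]
  simp only [add_zero, ← add_assoc, add_right_comm n _ 1] at htail ⊢
  have := norm_le_norm_add_norm_sub' (s n • (d n (σ n) - d n (ω n))) (-∑' i,
    s (n + 1 + i) • (d (n + 1 + i) (σ (n + 1 + i)) - d (n + 1 + i) (ω (n + 1 + i))))
  rw [norm_neg, sub_neg_eq_add] at this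
  nlinarith [H.tail_le n]

/-- Points of the sum set whose digit sequences differ before place `n` are well separated. -/
theorem exists_le_dist_codingMap (H : SeparatedDigits s d κ τ M) {σ ω : ℕ → Fin N} {n : ℕ}
    (h : ¬ ∀ i < n, σ i = ω i) :
    ∃ j < n, (1 - M) * τ * s j ≤ dist (codingMap s d σ) (codingMap s d ω) := by
  classical
  have hex : ∃ j, j < n ∧ σ j ≠ ω j := by simpa only [not_forall, exists_prop] using h
  refine ⟨Nat.find hex, (Nat.find_spec hex).1,
    H.le_dist_codingMap_of_first_ne (fun i hi => ?_) (Nat.find_spec hex).2⟩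
  by_contra hne
  exact Nat.find_min hex hi ⟨hi.trans (Nat.find_spec hex).1, hne⟩

theorem gap_pos (H : SeparatedDigits s d κ τ M) (n : ℕ) : 0 < (1 - M) * τ * s n :=
  mul_pos (mul_pos (sub_pos.2 H.ratio_lt) H.tau_pos) (H.scale_pos n)

theorem gap_antitone (H : SeparatedDigits s d κ τ M) {m n : ℕ} (hmn : m ≤ n) :
    (1 - M) * τ * s n ≤ (1 - M) * τ * s m :=
  mul_le_mul_of_nonneg_left (H.scale_antitone hmn)
    (mul_pos (sub_pos.2 H.ratio_lt) H.tau_pos).le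

theorem tendsto_gap (H : SeparatedDigits s d κ τ M) :
    Tendsto (fun n => (1 - M) * τ * s n) atTop (𝓝 0) := by
  simpa only [mul_zero] using H.summable.tendsto_atTop_zero.const_mul ((1 - M) * τ)

theorem le_dist_codingMap (H : SeparatedDigits s d κ τ M) {σ ω : ℕ → Fin N} {n : ℕ}
    (h : ¬ ∀ i < n, σ i = ω i) :
    (1 - M) * τ * s n ≤ dist (codingMap s d σ) (codingMap s d ω) := by
  obtain ⟨j, hj, hle⟩ := H.exists_le_dist_codingMap h
  exact (H.gap_antitone hj.le).trans hle

/-- Here `κ R_n = κ s_n + κ R_{n+1} ≤ 2 κ s_n`, a fixed multiple of the half gap. -/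
theorem exists_tail_le_two_pow_mul_gap (H : SeparatedDigits s d κ τ M) :
    ∃ k : ℕ, ∀ n, κ * tailSum s n ≤ 2 ^ k * ((1 - M) * τ * s n / 2) := by
  have hg : 0 < (1 - M) * τ / 2 := half_pos (mul_pos (sub_pos.2 H.ratio_lt) H.tau_pos)
  obtain ⟨k, hk⟩ := pow_unbounded_of_one_lt (2 * κ / ((1 - M) * τ / 2)) (one_lt_two (α := ℝ))
  refine ⟨k, fun n => ?_⟩
  rw [div_lt_iff₀ hg] at hk
  have h1 := H.tail_le_term n
  have h2 : τ * s n ≤ κ * s n := mul_le_mul_of_nonneg_right H.tau_le (H.scale_pos n).le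
  have h3 := mul_le_mul_of_nonneg_right hk.le (H.scale_pos n).le
  rw [H.tailSum_eq_add n]
  linarith

end SeparatedDigits

theorem IsDoublingConstant.two_pow_mul_le {h : ℝ≥0 → ℝ≥0} {c : ℝ≥0}
    (hc : IsDoublingConstant h c) {x : ℝ≥0} (hx : 0 < x) (k : ℕ) :
    h (2 ^ k * x) ≤ c ^ k * h x := by
  induction k with
  | zero => simp
  | succ k ih =>
    calc h (2 ^ (k + 1) * x) = h (2 * (2 ^ k * x)) := by rw [pow_succ']; ring_nf
      _ ≤ c * h (2 ^ k * x) := hc.2 _ (by positivity)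
      _ ≤ c * (c ^ k * h x) := by gcongr
      _ = c ^ (k + 1) * h x := by ring

/-- This is where both lower bounds use doubling. -/
theorem SeparatedDigits.exists_gauge_tail_le {s : ℕ → ℝ}
    {d : ℕ → Fin N → EuclideanSpace ℝ (Fin p)} {κ τ M : ℝ} (H : SeparatedDigits s d κ τ M)
    {h : ℝ≥0 → ℝ≥0} (hh : IsDimensionFunction h) (hd : IsDoubling h) :
    ∃ K : ℝ≥0, 0 < K ∧ ∀ n,
      h (κ * tailSum s n).toNNReal ≤ K * h ((1 - M) * τ * s n / 2).toNNReal := by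
  obtain ⟨c, hc⟩ := hd
  obtain ⟨k, hk⟩ := H.exists_tail_le_two_pow_mul_gap
  refine ⟨c ^ k, pow_pos hc.1 k, fun n => ?_⟩
  refine le_trans (hh.monotone ?_)
    (hc.two_pow_mul_le (Real.toNNReal_pos.2 (half_pos (H.gap_pos n))) k)
  rw [Real.toNNReal_le_iff_le_coe]
  push_cast
  rw [Real.coe_toNNReal _ (half_pos (H.gap_pos n)).le]
  exact hk n

end Coding

/-! ### The uniform measure on digit sequences. -/

section BernoulliMeasure

variable {N : ℕ} [NeZero N]

variable (N) in
/-- The uniform Bernoulli measure on digit sequences. -/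
noncomputable def bernoulliMeasure : Measure (ℕ → Fin N) :=
  Measure.infinitePi fun _ => (PMF.uniformOfFintype (Fin N)).toMeasure

instance : IsProbabilityMeasure (bernoulliMeasure N) := by
  unfold bernoulliMeasure
  infer_instance

theorem bernoulliMeasure_cylinder (σ : ℕ → Fin N) (n : ℕ) :
    bernoulliMeasure N {ω | ∀ i < n, σ i = ω i} = ((N : ℝ≥0∞) ^ n)⁻¹ := by
  have hset : {ω : ℕ → Fin N | ∀ i < n, σ i = ω i} =
      Set.pi (Finset.range n : Set ℕ) fun i => {σ i} := by
    ext ω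
    simp [eq_comm]
  rw [hset, bernoulliMeasure, Measure.infinitePi_pi _ fun i _ => measurableSet_singleton _]
  simp [ENNReal.inv_pow]

/-- The measure of a set is at most the proportion of cylinders of length `n` that it meets. -/
theorem bernoulliMeasure_le_card_mul (S : Set (ℕ → Fin N)) (n : ℕ) :
    bernoulliMeasure N S ≤
      Nat.card ((fun (σ : ℕ → Fin N) (i : Fin n) => σ i) '' S) * ((N : ℝ≥0∞) ^ n)⁻¹ := by
  classical
  set W := (fun (σ : ℕ → Fin N) (i : Fin n) => σ i) '' S
  have hW : ∀ w : W, ∃ σ ∈ S, (fun i : Fin n => σ i) = w := fun w => w.2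
  choose f _ hf using hW
  have hcov : S ⊆ ⋃ w : W, {ω | ∀ i < n, f w i = ω i} := by
    intro σ hσ
    refine mem_iUnion.2 ⟨⟨_, mem_image_of_mem _ hσ⟩, fun i hi => ?_⟩
    exact congrFun (hf ⟨_, mem_image_of_mem _ hσ⟩) ⟨i, hi⟩
  calc bernoulliMeasure N S ≤ ∑' w : W, bernoulliMeasure N {ω | ∀ i < n, f w i = ω i} :=
        (measure_mono hcov).trans (measure_iUnion_le _)
    _ = _ := by
        simp only [bernoulliMeasure_cylinder, tsum_fintype, Finset.sum_const, nsmul_eq_mul,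
          Finset.card_univ, Nat.card_eq_fintype_card]

end BernoulliMeasure

/-! ### Hausdorff measure bounds. -/

namespace SeparatedDigits

variable {p N : ℕ} {s : ℕ → ℝ} {d : ℕ → Fin N → EuclideanSpace ℝ (Fin p)} {κ τ M : ℝ}
  {h : ℝ≥0 → ℝ≥0}

theorem hausdorffGaugeMeasure_le (H : SeparatedDigits s d κ τ M) (hh : Monotone h) :
    hausdorffGaugeMeasure h (sumSet s d) ≤
      liminf (fun n => (N : ℝ≥0∞) ^ n * (h (κ * tailSum s n).toNNReal : ℝ≥0∞)) atTop := by
  let t : ∀ n : ℕ, (Fin n → Fin N) → Set (EuclideanSpace ℝ (Fin p)) :=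
    fun n w => codingMap s d '' {σ | (fun i : Fin n => σ i) = w}
  have ht : ∀ n w, Metric.ediam (t n w) ≤ ENNReal.ofReal (κ * tailSum s n) := by
    refine fun n w => Metric.ediam_le_of_forall_dist_le ?_
    rintro _ ⟨σ, rfl, rfl⟩ _ ⟨ω, hω, rfl⟩
    exact H.dist_codingMap_le fun i hi => (congrFun hω ⟨i, hi⟩).symm
  have hlim : Tendsto (fun n => ENNReal.ofReal (κ * tailSum s n)) atTop (𝓝 0) := by
    simpa using ENNReal.tendsto_ofReal (tendsto_mul_tailSum κ s)
  have hcov : ∀ n, sumSet s d ⊆ ⋃ w, t n w := by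
    intro n x hx
    rw [H.sumSet_eq_range] at hx
    obtain ⟨σ, rfl⟩ := hx
    exact mem_iUnion.2 ⟨_, mem_image_of_mem _ rfl⟩
  refine (Measure.mkMetric_le_liminf_sum _ _ hlim t (Eventually.of_forall ht)
    (Eventually.of_forall hcov) _).trans (liminf_le_liminf (Eventually.of_forall fun n => ?_))
  have hterm : ∀ w ∈ Finset.univ, (if Metric.ediam (t n w) = ⊤ then (⊤ : ℝ≥0∞)
      else (h (Metric.ediam (t n w)).toNNReal : ℝ≥0∞)) ≤ h (κ * tailSum s n).toNNReal := by
    intro w _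
    rw [if_neg (ne_top_of_le_ne_top ENNReal.ofReal_ne_top (ht n w)), ENNReal.coe_le_coe]
    exact hh (ENNReal.toNNReal_mono ENNReal.ofReal_ne_top (ht n w))
  refine (Finset.sum_le_card_nsmul _ _ _ hterm).trans_eq ?_
  simp

theorem measurable_codingMap (H : SeparatedDigits s d κ τ M) : Measurable (codingMap s d) :=
  H.continuous_codingMap.measurable

variable [NeZero N]

/-- A set containing a coded point and smaller than all gaps before place `n` has Bernoulli
measure at most `N⁻ⁿ`. -/
theorem bernoulliMeasure_preimage_le (H : SeparatedDigits s d κ τ M)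
    {B : Set (EuclideanSpace ℝ (Fin p))} {D : ℝ} (hD : ∀ x ∈ B, ∀ y ∈ B, dist x y ≤ D) {n : ℕ}
    (hn : ∀ j < n, D < (1 - M) * τ * s j) :
    bernoulliMeasure N (codingMap s d ⁻¹' B) ≤ ((N : ℝ≥0∞) ^ n)⁻¹ := by
  rcases (codingMap s d ⁻¹' B).eq_empty_or_nonempty with he | ⟨σ, hσ⟩
  · simp [he]
  rw [← bernoulliMeasure_cylinder σ n]
  refine measure_mono fun ω hω => ?_
  by_contra hne
  obtain ⟨j, hj, hle⟩ := H.exists_le_dist_codingMap hne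
  exact absurd (hle.trans (hD _ hσ _ hω)) (hn j hj).not_ge

theorem hausdorffGaugeMeasure_pos (H : SeparatedDigits s d κ τ M) (hN : 2 ≤ N)
    (hh : IsDimensionFunction h) (hd : IsDoubling h)
    (hpos : 0 < liminf (fun n => (N : ℝ≥0∞) ^ n * (h (κ * tailSum s n).toNNReal : ℝ≥0∞)) atTop) :
    0 < hausdorffGaugeMeasure h (sumSet s d) := by
  obtain ⟨K, hK, hKle⟩ := H.exists_gauge_tail_le hh hd
  obtain ⟨β, hβ0, hβ⟩ := ENNReal.lt_iff_exists_nnreal_btwn.1 hpos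
  obtain ⟨n₀, hn₀⟩ := eventually_atTop.1 (eventually_lt_of_lt_liminf hβ)
  have hN0 : ∀ n, (N : ℝ≥0∞) ^ n ≠ 0 := fun n => pow_ne_zero n (Nat.cast_ne_zero.2 (NeZero.ne N))
  have hNtop : ∀ n, (N : ℝ≥0∞) ^ n ≠ ⊤ := fun n => ENNReal.pow_ne_top (ENNReal.natCast_ne_top N)
  have hK0 : (K : ℝ≥0∞) ≠ 0 := by exact_mod_cast hK.ne'
  have hβK : (β : ℝ≥0∞) / K ≠ 0 := ENNReal.div_ne_zero.2 ⟨hβ0.ne', ENNReal.coe_ne_top⟩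
  have hle : ((β : ℝ≥0∞) / K) • (bernoulliMeasure N).map (codingMap s d) ≤
      hausdorffGaugeMeasure h := by
    refine Measure.le_mkMetric _ _ (ENNReal.ofReal ((1 - M) * τ * s n₀ / 2))
      (ENNReal.ofReal_pos.2 (half_pos (H.gap_pos n₀))) fun B hB => ?_
    have hBtop : Metric.ediam B ≠ ⊤ := ne_top_of_le_ne_top ENNReal.ofReal_ne_top hB
    -- `B` may fail to be measurable; its closure is measurable and has the same diameter.
    have hcl : Metric.ediam (closure B) ≠ ⊤ := by rwa [Metric.ediam_closure]
    have hdist : ∀ x ∈ closure B, ∀ y ∈ closure B, dist x y ≤ (Metric.ediam B).toReal := by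
      intro x hx y hy
      rw [← Metric.ediam_closure, dist_edist]
      exact ENNReal.toReal_mono hcl (Metric.edist_le_ediam_of_mem hx hy)
    have hDlt : (Metric.ediam B).toReal < (1 - M) * τ * s n₀ := by
      have := ENNReal.toReal_le_of_le_ofReal (half_pos (H.gap_pos n₀)).le hB
      linarith [H.gap_pos n₀]
    have hmap : (bernoulliMeasure N).map (codingMap s d) B ≤
        bernoulliMeasure N (codingMap s d ⁻¹' closure B) := by
      rw [← Measure.map_apply H.measurable_codingMap isClosed_closure.measurableSet]
      exact measure_mono subset_closure
    rw [if_neg hBtop, Measure.smul_apply, smul_eq_mul]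
    rcases (ENNReal.toReal_nonneg (a := Metric.ediam B)).eq_or_lt with hD | hD
    -- At diameter 0 the gauge may vanish, so the mass must: the set lies in one cylinder of every
    -- length, and `N ≥ 2`.
    · have hzero : bernoulliMeasure N (codingMap s d ⁻¹' closure B) ≤ 0 := by
        have hlim : Tendsto (fun n : ℕ => ((N : ℝ≥0∞)⁻¹) ^ n) atTop (𝓝 0) :=
          ENNReal.tendsto_pow_atTop_nhds_zero_of_lt_one
            (ENNReal.inv_lt_one.2 (by exact_mod_cast hN))
        refine ge_of_tendsto' hlim fun n => ?_
        rw [← ENNReal.inv_pow]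
        exact H.bernoulliMeasure_preimage_le hdist fun j _ => hD ▸ H.gap_pos j
      rw [le_antisymm (hmap.trans hzero) zero_le, mul_zero]
      exact zero_le
    · classical
      -- For the first `n` whose gap is at most the diameter, all earlier gaps exceed it, so the
      -- coded points of `closure B` share their first `n` digits.
      have hex : ∃ n, (1 - M) * τ * s n ≤ (Metric.ediam B).toReal :=
        ((H.tendsto_gap.eventually_lt_const hD).exists).imp fun _ => le_of_lt
      set n := Nat.find hex
      have hn : (1 - M) * τ * s n ≤ (Metric.ediam B).toReal := Nat.find_spec hex
      have hn₀n : n₀ ≤ n := by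
        by_contra hlt
        exact (hn.trans_lt hDlt).not_ge (H.gap_antitone (not_le.1 hlt).le)
      have hmeas : bernoulliMeasure N (codingMap s d ⁻¹' closure B) ≤ ((N : ℝ≥0∞) ^ n)⁻¹ :=
        H.bernoulliMeasure_preimage_le hdist fun j hj => not_le.1 (Nat.find_min hex hj)
      have hgauge : h (κ * tailSum s n).toNNReal ≤ K * h (Metric.ediam B).toNNReal := by
        refine (hKle n).trans (mul_le_mul_right (hh.monotone ?_) K)
        rw [Real.toNNReal_le_iff_le_coe]
        exact (half_le_self (H.gap_pos n).le).trans hn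
      calc (β : ℝ≥0∞) / K * (bernoulliMeasure N).map (codingMap s d) B
          ≤ (N : ℝ≥0∞) ^ n * (K * h (Metric.ediam B).toNNReal) / K * ((N : ℝ≥0∞) ^ n)⁻¹ := by
            gcongr
            · exact (hn₀ n hn₀n).le.trans (by gcongr; exact_mod_cast hgauge)
            · exact hmap.trans hmeas
        _ = ((N : ℝ≥0∞) ^ n * ((N : ℝ≥0∞) ^ n)⁻¹) * ((K : ℝ≥0∞) * (K : ℝ≥0∞)⁻¹) *
              h (Metric.ediam B).toNNReal := by
            rw [div_eq_mul_inv]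
            ring
        _ = h (Metric.ediam B).toNNReal := by
            rw [ENNReal.mul_inv_cancel (hN0 n) (hNtop n),
              ENNReal.mul_inv_cancel hK0 ENNReal.coe_ne_top, one_mul, one_mul]
  refine lt_of_lt_of_le ?_ (hle (sumSet s d))
  have hone : 1 ≤ (bernoulliMeasure N).map (codingMap s d) (sumSet s d) := by
    refine le_trans ?_ (Measure.le_map_apply H.measurable_codingMap.aemeasurable _)
    rw [H.sumSet_eq_range, preimage_range, measure_univ]
  rw [Measure.smul_apply, smul_eq_mul]
  exact ENNReal.mul_pos hβK (zero_lt_one.trans_le hone).ne'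

/-! ### Packing measure bounds. -/

/-- Packings of the sum set by small balls have total gauge at most `N β` whenever the
quantities `Nⁿ h(κ Rₙ)` are eventually at most `β`. -/
theorem exists_packing_tsum_le (H : SeparatedDigits s d κ τ M) (hh : Monotone h) {β : ℝ≥0∞}
    (hβ : ∀ᶠ n in atTop, (N : ℝ≥0∞) ^ n * (h (κ * tailSum s n).toNNReal : ℝ≥0∞) ≤ β) :
    ∃ δ : ℝ≥0, 0 < δ ∧ ∀ T, IsPacking δ (sumSet s d) T →
      ∑' b : T, (h b.1.2 : ℝ≥0∞) ≤ N * β := by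
  obtain ⟨n₀, hn₀⟩ := eventually_atTop.1 hβ
  have hRpos : ∀ n, 0 < κ * tailSum s n := fun n => mul_pos H.kappa_pos (H.tailSum_pos n)
  have hRanti : Antitone fun n => κ * tailSum s n := antitone_nat_of_succ_le fun n => by
    have := H.tailSum_eq_add n
    exact mul_le_mul_of_nonneg_left (by linarith [H.scale_pos n]) H.kappa_pos.le
  have hN0 : ∀ n, (N : ℝ≥0∞) ^ n ≠ 0 := fun n => pow_ne_zero n (Nat.cast_ne_zero.2 (NeZero.ne N))
  have hNtop : ∀ n, (N : ℝ≥0∞) ^ n ≠ ⊤ := fun n => ENNReal.pow_ne_top (ENNReal.natCast_ne_top N)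
  refine ⟨(κ * tailSum s n₀).toNNReal, Real.toNNReal_pos.2 (hRpos n₀), fun T hT => ?_⟩
  have hball : ∀ b : T, (h b.1.2 : ℝ≥0∞) ≤
      N * β * bernoulliMeasure N (codingMap s d ⁻¹' Metric.ball b.1.1 (b.1.2 : ℝ)) := by
    classical
    rintro ⟨⟨x, r⟩, hb⟩
    have hr : (0 : ℝ) < r := hT.radius_pos _ hb
    have hrle : (r : ℝ) ≤ κ * tailSum s n₀ := by
      have := hT.radius_le _ hb
      rwa [← NNReal.coe_le_coe, Real.coe_toNNReal _ (hRpos n₀).le] at this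
    have hx := hT.center_mem _ hb
    rw [H.sumSet_eq_range] at hx
    obtain ⟨σ, hσ⟩ := hx
    have hex : ∃ n, κ * tailSum s n < r :=
      ((tendsto_mul_tailSum κ s).eventually_lt_const hr).exists
    -- Now `κ R_{m+1} < r ≤ κ R_m`: the ball contains a cylinder of length `m + 1`, while its gauge
    -- is bounded at level `m`. This shift is the source of the factor `N`.
    obtain ⟨m, hm⟩ : ∃ m, Nat.find hex = m + 1 := Nat.exists_eq_succ_of_ne_zero fun h0 => by
      have h1 := Nat.find_spec hex
      rw [h0] at h1
      exact (h1.trans_le hrle).not_ge (hRanti (Nat.zero_le n₀))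
    have hlt : κ * tailSum s (m + 1) < r := hm ▸ Nat.find_spec hex
    have hge : (r : ℝ) ≤ κ * tailSum s m :=
      not_lt.1 (Nat.find_min hex (hm ▸ Nat.lt_succ_self m))
    have hmn : n₀ ≤ m := by
      by_contra hcon
      exact (hlt.trans_le hrle).not_ge (hRanti (not_le.1 hcon))
    have hmeas : ((N : ℝ≥0∞) ^ (m + 1))⁻¹ ≤
        bernoulliMeasure N (codingMap s d ⁻¹' Metric.ball x (r : ℝ)) := by
      rw [← bernoulliMeasure_cylinder σ]
      refine measure_mono fun ω hω => ?_
      rw [mem_preimage, Metric.mem_ball', ← show codingMap s d σ = x from hσ]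
      exact (H.dist_codingMap_le hω).trans_lt hlt
    have hgauge : (h r : ℝ≥0∞) ≤ h (κ * tailSum s m).toNNReal :=
      ENNReal.coe_le_coe.2 (hh (NNReal.le_toNNReal_of_coe_le hge))
    calc (h r : ℝ≥0∞) = N ^ (m + 1) * h r * ((N : ℝ≥0∞) ^ (m + 1))⁻¹ := by
          rw [mul_right_comm, ENNReal.mul_inv_cancel (hN0 _) (hNtop _), one_mul]
      _ = N * (N ^ m * h r) * ((N : ℝ≥0∞) ^ (m + 1))⁻¹ := by rw [pow_succ']; ring
      _ ≤ N * β * bernoulliMeasure N (codingMap s d ⁻¹' Metric.ball x (r : ℝ)) := by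
          gcongr
          exact le_trans (by gcongr) (hn₀ m hmn)
  have hdisj : Pairwise (Function.onFun Disjoint fun b : T =>
      codingMap s d ⁻¹' Metric.ball b.1.1 (b.1.2 : ℝ)) := fun a b hab =>
    (hT.disjoint a.2 b.2 fun h => hab (Subtype.ext h)).preimage _
  calc ∑' b : T, (h b.1.2 : ℝ≥0∞)
      ≤ ∑' b : T, N * β * bernoulliMeasure N (codingMap s d ⁻¹' Metric.ball b.1.1 (b.1.2 : ℝ)) :=
        ENNReal.tsum_le_tsum hball
    _ = N * β * ∑' b : T, bernoulliMeasure N (codingMap s d ⁻¹' Metric.ball b.1.1 (b.1.2 : ℝ)) :=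
        ENNReal.tsum_mul_left
    _ ≤ N * β * 1 := by
        gcongr
        exact (tsum_meas_le_meas_iUnion_of_disjoint _
          (fun b => H.measurable_codingMap Metric.isOpen_ball.measurableSet) hdisj).trans prob_le_one
    _ = N * β := mul_one _

/-- The general weight `w` serves both packing measures: `c = 1` for radii, a doubling constant for
diameters. -/
theorem packingOuter_le (H : SeparatedDigits s d κ τ M) (hh : Monotone h)
    {w : EuclideanSpace ℝ (Fin p) → ℝ≥0 → ℝ≥0} {c : ℝ≥0} (hc : 0 < c)
    (hw : ∀ x r, 0 < r → w x r ≤ c * h r) :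
    packingOuter w (sumSet s d) ≤ c * (N *
      limsup (fun n => (N : ℝ≥0∞) ^ n * (h (κ * tailSum s n).toNNReal : ℝ≥0∞)) atTop) := by
  set α := limsup (fun n => (N : ℝ≥0∞) ^ n * (h (κ * tailSum s n).toNNReal : ℝ≥0∞)) atTop
  have hpre : ∀ β, α < β → packingPre w (sumSet s d) ≤ c * (N * β) := by
    intro β hβ
    obtain ⟨δ, hδ, hT⟩ := H.exists_packing_tsum_le hh
      ((eventually_lt_of_limsup_lt hβ).mono fun _ => le_of_lt)
    refine (iInf₂_le δ hδ).trans (iSup₂_le fun T hpack => ?_)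
    calc ∑' b : T, (w b.1.1 b.1.2 : ℝ≥0∞) ≤ ∑' b : T, (c : ℝ≥0∞) * h b.1.2 :=
          ENNReal.tsum_le_tsum fun b => by exact_mod_cast hw _ _ (hpack.radius_pos _ b.2)
      _ = c * ∑' b : T, (h b.1.2 : ℝ≥0∞) := ENNReal.tsum_mul_left
      _ ≤ c * (N * β) := by gcongr; exact hT T hpack
  have hlim : packingPre w (sumSet s d) ≤ c * (N * α) := by
    rw [← mul_assoc]
    have hcN0 : (c : ℝ≥0∞) * N ≠ 0 :=
      mul_ne_zero (ENNReal.coe_ne_zero.2 hc.ne') (Nat.cast_ne_zero.2 (NeZero.ne N))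
    have hcN : (c : ℝ≥0∞) * N ≠ ⊤ :=
      ENNReal.mul_ne_top ENNReal.coe_ne_top (ENNReal.natCast_ne_top N)
    refine ENNReal.le_mul_of_forall_lt (Or.inl hcN0) (Or.inl hcN) fun a ha β hβ => ?_
    exact (hpre β hβ).trans (by rw [← mul_assoc]; gcongr)
  have hempty : packingPre w (∅ : Set (EuclideanSpace ℝ (Fin p))) = 0 := by
    refine le_antisymm ((iInf₂_le 1 zero_lt_one).trans (iSup₂_le fun T hT => ?_)) zero_le
    have : IsEmpty T := ⟨fun b => hT.center_mem _ b.2⟩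
    simp
  refine le_trans ?_ hlim
  refine (iInf₂_le (fun i : ℕ => if i = 0 then sumSet s d else ∅) fun x hx =>
    mem_iUnion.2 ⟨0, by simpa using hx⟩).trans_eq ?_
  rw [tsum_eq_single 0 fun i hi => by simp only [if_neg hi, hempty]]
  simp only [if_true]

/-- Picking one point of `A` in each cylinder of length `n` that meets `A` gives a packing. -/
theorem bernoulliMeasure_mul_le_packingDelta (H : SeparatedDigits s d κ τ M)
    {w : EuclideanSpace ℝ (Fin p) → ℝ≥0 → ℝ≥0} (hw : ∀ x r, h r ≤ w x r)
    (A : Set (EuclideanSpace ℝ (Fin p))) {δ : ℝ≥0} {n : ℕ}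
    (hδ : ((1 - M) * τ * s n / 2).toNNReal ≤ δ) :
    bernoulliMeasure N (codingMap s d ⁻¹' A) *
      ((N : ℝ≥0∞) ^ n * h ((1 - M) * τ * s n / 2).toNNReal) ≤ packingDelta w δ A := by
  set r := ((1 - M) * τ * s n / 2).toNNReal
  have hrpos : 0 < r := Real.toNNReal_pos.2 (half_pos (H.gap_pos n))
  have hrcoe : (r : ℝ) = (1 - M) * τ * s n / 2 := Real.coe_toNNReal _ (half_pos (H.gap_pos n)).le
  set W := (fun (σ : ℕ → Fin N) (i : Fin n) => σ i) '' (codingMap s d ⁻¹' A)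
  have hex : ∀ v : W, ∃ σ ∈ codingMap s d ⁻¹' A, (fun i : Fin n => σ i) = v := fun v => v.2
  choose f hfA hf using hex
  let g : W → EuclideanSpace ℝ (Fin p) × ℝ≥0 := fun v => (codingMap s d (f v), r)
  have hsep : ∀ u v : W, u ≠ v → (r : ℝ) + r ≤ dist (g u).1 (g v).1 := by
    intro u v huv
    rw [hrcoe, add_halves]
    refine H.le_dist_codingMap fun heq => huv (Subtype.ext ?_)
    rw [← hf u, ← hf v]
    exact funext fun i => heq i i.2
  -- A packing is a set of balls, so injectivity is needed to count one ball per cylinder.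
  have hginj : Function.Injective g := by
    intro u v huv
    by_contra hne
    have := hsep u v hne
    rw [huv, dist_self] at this
    have hr' : (0 : ℝ) < r := hrpos
    linarith
  have hpack : IsPacking δ A (range g) := by
    refine ⟨forall_mem_range.2 hfA, forall_mem_range.2 fun _ => hrpos,
      forall_mem_range.2 fun _ => hδ, ?_⟩
    rintro _ ⟨u, rfl⟩ _ ⟨v, rfl⟩ huv
    exact Metric.ball_disjoint_ball (hsep u v fun h => huv (h ▸ rfl))
  have hN0 : (N : ℝ≥0∞) ^ n ≠ 0 := pow_ne_zero n (Nat.cast_ne_zero.2 (NeZero.ne N))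
  have hNtop : (N : ℝ≥0∞) ^ n ≠ ⊤ := ENNReal.pow_ne_top (ENNReal.natCast_ne_top N)
  classical
  calc bernoulliMeasure N (codingMap s d ⁻¹' A) * ((N : ℝ≥0∞) ^ n * h r)
      ≤ Nat.card W * ((N : ℝ≥0∞) ^ n)⁻¹ * ((N : ℝ≥0∞) ^ n * h r) := by
        gcongr
        exact bernoulliMeasure_le_card_mul _ n
    _ = Nat.card W * h r := by
        rw [← mul_assoc, mul_assoc (Nat.card W : ℝ≥0∞), ENNReal.inv_mul_cancel hN0 hNtop, mul_one]
    _ = ∑' _ : W, (h r : ℝ≥0∞) := by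
        rw [tsum_fintype, Finset.sum_const, nsmul_eq_mul, Finset.card_univ,
          Nat.card_eq_fintype_card]
    _ ≤ ∑' v : W, (w (g v).1 (g v).2 : ℝ≥0∞) :=
        ENNReal.tsum_le_tsum fun v => ENNReal.coe_le_coe.2 (hw _ _)
    _ = ∑' b : range g, (w b.1.1 b.1.2 : ℝ≥0∞) :=
        (tsum_range (fun b : EuclideanSpace ℝ (Fin p) × ℝ≥0 => (w b.1 b.2 : ℝ≥0∞)) hginj).symm
    _ ≤ packingDelta w δ A := le_iSup₂_of_le (range g) hpack le_rfl

theorem packingOuter_pos (H : SeparatedDigits s d κ τ M)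
    (hh : IsDimensionFunction h) (hd : IsDoubling h)
    {w : EuclideanSpace ℝ (Fin p) → ℝ≥0 → ℝ≥0} (hw : ∀ x r, h r ≤ w x r)
    (hpos : 0 < limsup (fun n => (N : ℝ≥0∞) ^ n * (h (κ * tailSum s n).toNNReal : ℝ≥0∞)) atTop) :
    0 < packingOuter w (sumSet s d) := by
  obtain ⟨K, hK, hKle⟩ := H.exists_gauge_tail_le hh hd
  obtain ⟨β, hβ0, hβ⟩ := ENNReal.lt_iff_exists_nnreal_btwn.1 hpos
  have hfreq := frequently_lt_of_lt_limsup (by isBoundedDefault) hβ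
  have hK0 : (K : ℝ≥0∞) ≠ 0 := by exact_mod_cast hK.ne'
  have hβK : 0 < (β : ℝ≥0∞) / K := ENNReal.div_pos hβ0.ne' ENNReal.coe_ne_top
  -- The bound holds for arbitrary `A`, so it passes to countable covers by subadditivity of the
  -- outer measure.
  have hpre : ∀ A, (β : ℝ≥0∞) / K * bernoulliMeasure N (codingMap s d ⁻¹' A) ≤ packingPre w A := by
    refine fun A => le_iInf₂ fun δ hδ => ?_
    have hev : ∀ᶠ n in atTop, ((1 - M) * τ * s n / 2).toNNReal ≤ δ := by
      filter_upwards [H.tendsto_gap.eventually_lt_const (NNReal.coe_pos.2 hδ)] with n hn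
      rw [Real.toNNReal_le_iff_le_coe]
      linarith [H.gap_pos n]
    obtain ⟨n, hn, hnδ⟩ := (hfreq.and_eventually hev).exists
    refine le_trans ?_ (H.bernoulliMeasure_mul_le_packingDelta hw A hnδ)
    rw [mul_comm]
    gcongr
    rw [ENNReal.div_le_iff hK0 ENNReal.coe_ne_top]
    refine hn.le.trans ?_
    rw [mul_assoc, mul_comm _ (K : ℝ≥0∞)]
    gcongr
    exact_mod_cast hKle n
  refine hβK.trans_le (le_iInf₂ fun A hA => ?_)
  have hcover : 1 ≤ ∑' i, bernoulliMeasure N (codingMap s d ⁻¹' A i) := by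
    rw [← measure_univ (μ := bernoulliMeasure N)]
    refine (measure_mono fun σ _ => ?_).trans (measure_iUnion_le _)
    have := hA (H.sumSet_eq_range ▸ mem_range_self σ)
    simpa using this
  calc (β : ℝ≥0∞) / K ≤ β / K * ∑' i, bernoulliMeasure N (codingMap s d ⁻¹' A i) :=
        le_mul_of_one_le_right' hcover
    _ = ∑' i, (β : ℝ≥0∞) / K * bernoulliMeasure N (codingMap s d ⁻¹' A i) :=
        ENNReal.tsum_mul_left.symm
    _ ≤ ∑' i, packingPre w (A i) := ENNReal.tsum_le_tsum fun i => hpre (A i)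

end SeparatedDigits

/-! ### From extremal digit distances to the separation condition. -/

section Digits

variable {p N : ℕ}

theorem norm_sub_le_digitMax (e : Fin N → EuclideanSpace ℝ (Fin p)) {a b : Fin N} (hab : a ≠ b) :
    ‖e a - e b‖ ≤ digitMax e :=
  le_ciSup (f := fun q : {q : Fin N × Fin N // q.1 ≠ q.2} => ‖e q.1.1 - e q.1.2‖)
    (finite_range _).bddAbove ⟨(a, b), hab⟩

theorem digitMin_le_norm_sub (e : Fin N → EuclideanSpace ℝ (Fin p)) {a b : Fin N} (hab : a ≠ b) :
    digitMin e ≤ ‖e a - e b‖ :=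
  ciInf_le (f := fun q : {q : Fin N × Fin N // q.1 ≠ q.2} => ‖e q.1.1 - e q.1.2‖)
    (finite_range _).bddBelow ⟨(a, b), hab⟩

theorem digitTau_le_norm_sub (d : ℕ → Fin N → EuclideanSpace ℝ (Fin p)) (n : ℕ) {a b : Fin N}
    (hab : a ≠ b) : digitTau d ≤ ‖d n a - d n b‖ := by
  refine (ciInf_le ⟨0, ?_⟩ n).trans (digitMin_le_norm_sub (d n) hab)
  rintro _ ⟨m, rfl⟩
  exact Real.iInf_nonneg fun _ => norm_nonneg _

theorem norm_sub_le_digitKappa {d : ℕ → Fin N → EuclideanSpace ℝ (Fin p)}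
    (hκ : BddAbove (range fun n => digitMax (d n))) (n : ℕ) {a b : Fin N} (hab : a ≠ b) :
    ‖d n a - d n b‖ ≤ digitKappa d :=
  (norm_sub_le_digitMax (d n) hab).trans (le_ciSup hκ n)

theorem separatedDigits_of_isLUB (hN : 2 ≤ N) {s : ℕ → ℝ} (hs_pos : ∀ i, 0 < s i)
    (hs_sum : Summable s) {d : ℕ → Fin N → EuclideanSpace ℝ (Fin p)}
    {z : Fin N} (hd_zero : ∀ i, d i z = 0)
    (hκ : BddAbove (range fun n => digitMax (d n))) (hτ : 0 < digitTau d) {M : ℝ}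
    (hM_sup : IsLUB (range fun n => digitKappa d * tailSum s (n + 1) / (digitTau d * s n)) M)
    (hM : M < 1) : SeparatedDigits s d (digitKappa d) (digitTau d) M := by
  have hτκ : digitTau d ≤ digitKappa d := by
    have : Nontrivial (Fin N) := Fin.nontrivial_iff_two_le.2 hN
    obtain ⟨a, b, hne⟩ := exists_pair_ne (Fin N)
    exact (digitTau_le_norm_sub d 0 hne).trans (norm_sub_le_digitKappa hκ 0 hne)
  have hdist : ∀ i a b, ‖d i a - d i b‖ ≤ digitKappa d := by
    intro i a b
    by_cases hab : a = b
    · simpa [hab] using (hτ.trans_le hτκ).le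
    · exact norm_sub_le_digitKappa hκ i hab
  refine ⟨hs_pos, hs_sum, fun i a => ?_, hdist, fun i a b hab => digitTau_le_norm_sub d i hab,
    hτ, hτκ, fun n => ?_, hM⟩
  -- The zero digit turns the bound on differences into a bound on norms.
  · simpa [hd_zero i] using hdist i a z
  · exact (div_le_iff₀ (mul_pos hτ (hs_pos n))).1 (hM_sup.1 (mem_range_self n))

end Digits

theorem theorem1 {p N : ℕ} (hN : 2 ≤ N)
    (s : ℕ → ℝ) (hs_pos : ∀ i, 0 < s i) (hs_sum : Summable s)
    (d : ℕ → Fin N → EuclideanSpace ℝ (Fin p))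
    (hd_zero : ∀ i, d i ⟨0, by omega⟩ = 0)
    (hκ : BddAbove (Set.range fun n => digitMax (d n)))
    (hτ : 0 < digitTau d)
    (M : ℝ)
    (hM_sup : IsLUB
      (Set.range fun n => digitKappa d * tailSum s (n + 1) / (digitTau d * s n)) M)
    (hM : M < 1)
    (h : ℝ≥0 → ℝ≥0) (hh : IsDimensionFunction h) (hh_doubling : IsDoubling h) :
    (∀ α : ℝ≥0∞, liminf (gaugeSeq h s d) atTop = α →
      hausdorffGaugeMeasure h (sumSet s d) ≤ α) ∧
    (∀ α : ℝ≥0∞, liminf (gaugeSeq h s d) atTop = α → 0 < α →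
      0 < hausdorffGaugeMeasure h (sumSet s d)) ∧
    (∀ α : ℝ≥0∞, limsup (gaugeSeq h s d) atTop = α → α < ⊤ →
      packingMeasure h (sumSet s d) ≤ N * α ∧
      ∀ c : ℝ≥0, IsDoublingConstant h c →
        packingMeasureDiam h (sumSet s d) ≤ c * (N * α)) ∧
    (∀ α : ℝ≥0∞, limsup (gaugeSeq h s d) atTop = α → 0 < α →
      0 < packingMeasure h (sumSet s d) ∧ 0 < packingMeasureDiam h (sumSet s d)) := by
  have : NeZero N := ⟨by omega⟩
  have H := separatedDigits_of_isLUB hN hs_pos hs_sum hd_zero hκ hτ hM_sup hM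
  refine ⟨?_, ?_, ?_, ?_⟩
  · rintro _ rfl
    exact H.hausdorffGaugeMeasure_le hh.monotone
  · rintro _ rfl hα
    exact H.hausdorffGaugeMeasure_pos hN hh hh_doubling hα
  · rintro _ rfl -
    refine ⟨?_, fun c hc => H.packingOuter_le hh.monotone hc.1 fun x r hr => ?_⟩
    · have := H.packingOuter_le hh.monotone zero_lt_one fun _ r _ => (one_mul (h r)).ge
      rwa [ENNReal.coe_one, one_mul] at this
    · refine (hh.monotone ?_).trans (hc.2 r hr)
      rw [Real.toNNReal_le_iff_le_coe]
      exact Metric.diam_ball r.coe_nonneg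
  · rintro _ rfl hα
    refine ⟨H.packingOuter_pos hh hh_doubling (fun _ _ => le_rfl) hα,
      H.packingOuter_pos hh hh_doubling (fun x r => hh.monotone ?_) hα⟩
    have : Nontrivial (Fin N) := Fin.nontrivial_iff_two_le.2 hN
    obtain ⟨a, b, hne⟩ := exists_pair_ne (Fin N)
    -- Two distinct digits force `p ≥ 1`, so a ball has diameter exactly `2r ≥ r`.
    have : Nontrivial (EuclideanSpace ℝ (Fin p)) :=
      ⟨d 0 a, d 0 b, fun heq =>
        hτ.not_ge ((digitTau_le_norm_sub d 0 hne).trans_eq (by rw [heq, sub_self, norm_zero]))⟩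
    rw [Metric.diam_ball_eq x r.coe_nonneg]
    exact NNReal.le_toNNReal_of_coe_le (by linarith [r.coe_nonneg])
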